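/- Let $q \in (0,1)$ and $\theta = \min(q, 1-q)$. Let $\ell_q(v, p) = (1-q)\,((v-p)_+)^2 + q\,((p-v)_+)^2$ be the expectile loss, and for a distribution $D$ on $[0,1]$ let $\mathrm{EVaR}_q(D) = \arg\min_{p \in [0,1]} \mathbb{E}_{v \sim D}[\ell_q(v,p)]$. Let $\mathcal{A}$ be a finite nonempty action set, $\mathcal{X}$ a context space, and $\mathcal{F} \subseteq (\mathcal{X} \times \mathcal{A} \to [0,1])$. Protocol. In each round $t = 1, \dots, T$ an adaptive environment chooses, from the past (and possibly private information and randomness of its own), a context $x_t \in \mathcal{X}$ and a distribution $\mathbb{P}_{l_t}$ of a loss function $l_t : \mathcal{A} \to [0,1]$. The learner plays an action $a_t$ and observes $l_t(a_t)$, where, given what is known at that point, $l_t \sim \mathbb{P}_{l_t}$ is independent of $a_t$. Realizability: almost surely, some $f^* \in \mathcal{F}$ satisfies $f^*(x_t, a) = \mathrm{EVaR}_q((l_t)_a)$ for all $a \in \mathcal{A}$ and $t \le T$, where $\mathrm{EVaR}_q((l_t)_a)$ is $\mathrm{EVaR}_q$ of the law of $l_t(a)$ under $\mathbb{P}_{l_t}$.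 Oracle. An online regression oracle outputs, given $(x_s, a_s, l_s(a_s))_{s<t}$ and $x_t$, predictions $\hat f_t(x_t, \cdot) : \mathcal{A} \to [0,1]$. It is assumed that, for every sequence $(x_t, a_t, l_t)_{t \le T}$ and every $f \in \mathcal{F}$, $$\sum_{t=1}^T \Big( \ell_q\big(l_t(a_t), \hat f_t(x_t,a_t)\big) - \ell_q\big(l_t(a_t), f(x_t,a_t)\big) \Big) \le \mathrm{Reg}_{\mathrm{EVaR}_q}(T),$$ with a constant $\mathrm{Reg}_{\mathrm{EVaR}_q}(T) > 0$ that does not depend on the data. Algorithm (SquareCB with expectile loss and learning rate $\gamma > 0$). In round $t$, let $\hat a_t$ be an exact minimizer of $\hat f_t(x_t, \cdot)$ and draw $a_t$ from the distribution $\mathrm{AL}_t$ on $\mathcal{A}$ given by $$\mathrm{AL}_t(a) = \frac{1}{|\mathcal{A}| + 4\theta\gamma\,(\hat f_t(x_t,a) - \hat f_t(x_t,\hat a_t))} \quad (a \ne \hat a_t), \qquad \mathrm{AL}_t(\hat a_t) = 1 - \sum_{a \ne \hat a_t} \mathrm{AL}_t(a).$$ Theorem. There is a universal constant $C > 0$ such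 that the following holds. For all $|\mathcal{A}|$, $T$, $q$ and all values $\mathrm{Reg}_{\mathrm{EVaR}_q}(T) > 0$ there is a learning rate $\gamma > 0$, depending only on these four quantities, with which the algorithm guarantees, against every such environment and with every such oracle, that $$\mathbb{E}\big[\mathrm{Reg}_{CB}(T)\big] \le \frac{C}{\theta} \sqrt{|\mathcal{A}|\, T\, \mathrm{Reg}_{\mathrm{EVaR}_q}(T)}, \qquad \mathrm{Reg}_{CB}(T) = \sum_{t=1}^T \sum_{a \in \mathcal{A}} \mathrm{AL}_t(a) \Big( \mathrm{EVaR}_q\big((l_t)_a\big) - \min_{b \in \mathcal{A}} \mathrm{EVaR}_q\big((l_t)_b\big) \Big).$$ -/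

import Mathlib

open MeasureTheory ProbabilityTheory Finset
open scoped unitInterval

noncomputable section

namespace ExpectileBandit

/-! ### Expectile loss and the risk measure -/

/-- The expectile loss of the prediction `p` when the realized value is `v`:
`(1 - q) ((v - p)_+)^2 + q ((p - v)_+)^2`. -/
def expectileLoss (q v p : ℝ) : ℝ :=
  (1 - q) * (max (v - p) 0) ^ 2 + q * (max (p - v) 0) ^ 2

/-- The minimizers over `[0, 1]` of the expected expectile loss under the distribution `D`. -/
def expectiles (q : ℝ) (D : Measure ℝ) : Set ℝ :=
  {p | p ∈ Set.Icc (0 : ℝ) 1 ∧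
    IsMinOn (fun p' : ℝ => ∫ v, expectileLoss q v p' ∂D) (Set.Icc (0 : ℝ) 1) p}

/-- `EVaR_q(D)`, the argmin over `[0, 1]` of the expected expectile loss. For `0 < q < 1` and a
probability distribution `D` on `[0, 1]`, the set `expectiles q D` has exactly one element (the
expected loss is continuous and strongly convex), and `evar q D` is that element. -/
def evar (q : ℝ) (D : Measure ℝ) : ℝ := sInf (expectiles q D)

/-! ### The online regression oracle -/

/-- An online regression oracle. Before round `t` it has seen the examples
`(x_s, a_s, l_s(a_s))`, `s < t`; given these and the context `x_t`, it outputs the predictions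
`a ↦ f̂_t(x_t, a)` in `[0, 1]`. -/
abbrev RegOracle (X A : Type*) : Type _ :=
  (t : ℕ) → (Fin t → X × A × I) → X → A → I

/-- The examples of the rounds before `t`. -/
def examples {X A : Type*} (x : ℕ → X) (a : ℕ → A) (y : ℕ → I) (t : ℕ) : Fin t → X × A × I :=
  fun s => (x s, a s, y s)

/-- The oracle's predictions depend measurably on the examples seen and on the context. -/
def RegOracle.IsMeasurable {X A : Type*} [MeasurableSpace X] [MeasurableSpace A]
    (oracle : RegOracle X A) : Prop :=
  ∀ (t : ℕ) (a : A), Measurable fun p : (Fin t → X × A × I) × X => oracle t p.1 p.2 a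

/-- The cumulative expectile loss of the oracle over `T` rounds exceeds that of any `f ∈ F` by at
most `R`, for every sequence of contexts, actions and realized losses. (The oracle's predictions
are functions of the past, so adaptively chosen sequences are included.) -/
def RegOracle.HasRegret {X A : Type*} (oracle : RegOracle X A) (q : ℝ) (F : Set (X → A → I))
    (T : ℕ) (R : ℝ) : Prop :=
  ∀ (x : ℕ → X) (a : ℕ → A) (y : ℕ → I), ∀ f ∈ F,
    ∑ t ∈ range T,
      (expectileLoss q (y t) (oracle t (examples x a y t) (x t) (a t))
        - expectileLoss q (y t) (f (x t) (a t))) ≤ R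

/-! ### The algorithm -/

/-- The inverse gap weighting distribution `AL(f̂, â)` with learning rate `γ`, where `f a` is the
prediction for action `a` and `θ = min(q, 1 - q)`. -/
def invGapWeight {A : Type*} [Fintype A] [DecidableEq A] (q γ : ℝ) (f : A → I) (ahat a : A) : ℝ :=
  if a = ahat then
    1 - ∑ b ∈ univ.erase ahat,
      1 / ((Fintype.card A : ℝ) + 4 * min q (1 - q) * γ * ((f b : ℝ) - (f ahat : ℝ)))
  else
    1 / ((Fintype.card A : ℝ) + 4 * min q (1 - q) * γ * ((f a : ℝ) - (f ahat : ℝ)))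

/-- The random variables of an interaction of the algorithm with an adaptive environment.
* `known t` is the information available in round `t` just before the action and the loss function
  are drawn. It may hold private information and randomness of the environment.
* `ctx t` is the context `x_t`, `lossLaw t` the distribution `ℙ_{l_t}` of the loss function that the
  environment has chosen, and `loss t` the loss function `l_t`.
* `greedy t` is the output `â_t` of the optimization oracle, and `act t` is the action `a_t`. -/
structure Interaction (X A Ω : Type*) [mΩ : MeasurableSpace Ω] where
  known : Filtration ℕ mΩ
  ctx : ℕ → Ω → X
  lossLaw : ℕ → Ω → Measure (A → I)
  loss : ℕ → Ω → A → I
  greedy : ℕ → Ω → A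
  act : ℕ → Ω → A

namespace Interaction

variable {X A Ω : Type*} [MeasurableSpace X] [MeasurableSpace Ω]

/-- The oracle's predictions `a ↦ f̂_t(x_t, a)` in round `t`. -/
def pred (E : Interaction X A Ω) (oracle : RegOracle X A) (t : ℕ) (ω : Ω) : A → I :=
  oracle t (examples (fun s => E.ctx s ω) (fun s => E.act s ω)
    (fun s => E.loss s ω (E.act s ω)) t) (E.ctx t ω)

/-- The risk `EVaR_q((l_t)_a)` of action `a` in round `t`: it is a function of the distribution of
`l_t(a)` chosen by the environment. -/
def risk (E : Interaction X A Ω) (q : ℝ) (t : ℕ) (ω : Ω) (a : A) : ℝ :=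
  evar q ((E.lossLaw t ω).map fun l : A → I => (l a : ℝ))

/-- The probability with which the algorithm plays action `a` in round `t`. -/
def prob [Fintype A] [DecidableEq A] (E : Interaction X A Ω) (oracle : RegOracle X A)
    (q γ : ℝ) (t : ℕ) (ω : Ω) (a : A) : ℝ :=
  invGapWeight q γ (E.pred oracle t ω) (E.greedy t ω) a

/-- During the first `T` rounds, the variables follow the protocol: the environment chooses the
context and the distribution of the loss function from what is known; `â_t` is an exact minimizer
of `f̂_t(x_t, ·)`; then, given what is known, `a_t` is drawn from `AL(f̂_t, â_t)` and, independently,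
`l_t` from the distribution chosen by the environment. -/
structure FollowsProtocol [Fintype A] [DecidableEq A] [MeasurableSpace A]
    (E : Interaction X A Ω) (P : Measure Ω) (oracle : RegOracle X A) (q γ : ℝ) (T : ℕ) :
    Prop where
  measurable_ctx : ∀ t < T, Measurable[E.known t] (E.ctx t)
  measurable_lossLaw : ∀ t < T, Measurable[E.known t] (E.lossLaw t)
  measurable_greedy : ∀ t < T, Measurable[E.known t] (E.greedy t)
  measurable_act : ∀ t < T, Measurable[E.known (t + 1)] (E.act t)
  measurable_loss : ∀ t < T, Measurable[E.known (t + 1)] (E.loss t)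
  isProbabilityMeasure_lossLaw : ∀ t < T, ∀ ω, IsProbabilityMeasure (E.lossLaw t ω)
  greedy_le : ∀ t < T, ∀ᵐ ω ∂P, ∀ a, E.pred oracle t ω (E.greedy t ω) ≤ E.pred oracle t ω a
  law_act_loss : ∀ t < T, ∀ S : Set Ω, MeasurableSet[E.known t] S →
    ∀ (a : A) (B : Set (A → I)), MeasurableSet B →
      P (S ∩ {ω | E.act t ω = a ∧ E.loss t ω ∈ B}) =
        ∫⁻ ω in S, ENNReal.ofReal (E.prob oracle q γ t ω a) * E.lossLaw t ω B ∂P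

/-- Realizability: almost surely, some `f ∈ F` gives the risk of every action in every context
encountered during the `T` rounds. -/
def Realizable (E : Interaction X A Ω) (P : Measure Ω) (q : ℝ) (F : Set (X → A → I))
    (T : ℕ) : Prop :=
  ∀ᵐ ω ∂P, ∃ f ∈ F, ∀ t < T, ∀ a, (f (E.ctx t ω) a : ℝ) = E.risk q t ω a

/-- The contextual bandit regret `Reg_CB(T)` along the trajectory `ω`: the sum over the rounds of
the expectation, over the algorithm's action distribution, of the excess of the risk of the action
over the smallest risk of an action. -/
def regCB [Fintype A] [DecidableEq A] (E : Interaction X A Ω) (oracle : RegOracle X A)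
    (q γ : ℝ) (T : ℕ) (ω : Ω) : ℝ :=
  ∑ t ∈ range T, ∑ a, E.prob oracle q γ t ω a * (E.risk q t ω a - ⨅ b, E.risk q t ω b)

end Interaction

end ExpectileBandit

end

open ExpectileBandit

/-!
The expected expectile loss of a distribution `D` is strongly convex in the prediction: it grows at
least like `θ (p - EVaR_q(D)) ^ 2` away from its minimizer, `θ = min q (1 - q)`. Under
realizability the oracle competes with the predictor that outputs the risks themselves, so
conditioning each round on the past turns its pathwise regret bound `R` into the bound `R / θ` on
the expected total squared error of its predictions, averaged over the algorithm's action
distribution. Inverse gap weighting makes the regret of a round at most `|A| / (2 θ γ) + 2 θ γ e`,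
`e` the squared error: by AM-GM the error on the best action is paid for by its playing probability,
whose inverse is at most `|A| + 4 θ γ · gap`, and the gap term cancels against the gap of the best
action in the regret. Summing over rounds gives `|A| T / (2 θ γ) + 2 γ R`, and the `γ` that
balances the two terms gives the bound with `C = 2`.
-/

open scoped ENNReal

namespace ExpectileBandit

section ExpectileLoss

/-- Half the derivative of `p ↦ expectileLoss q v p`; its mean under a distribution on `[0, 1]`
vanishes exactly at the expectile. -/
noncomputable def expectileSlope (q v p : ℝ) : ℝ :=
  q * max (p - v) 0 - (1 - q) * max (v - p) 0

variable {q v p : ℝ}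

@[fun_prop]
lemma continuous_expectileLoss (q : ℝ) : Continuous fun z : ℝ × ℝ => expectileLoss q z.1 z.2 := by
  unfold expectileLoss; fun_prop

@[fun_prop]
lemma continuous_expectileSlope (q : ℝ) :
    Continuous fun z : ℝ × ℝ => expectileSlope q z.1 z.2 := by
  unfold expectileSlope; fun_prop

lemma expectileLoss_nonneg (hq : q ∈ Set.Icc (0 : ℝ) 1) : 0 ≤ expectileLoss q v p :=
  add_nonneg (mul_nonneg (sub_nonneg.2 hq.2) (sq_nonneg _)) (mul_nonneg hq.1 (sq_nonneg _))

lemma expectileLoss_le_sq (hq : q ∈ Set.Icc (0 : ℝ) 1) : expectileLoss q v p ≤ (p - v) ^ 2 := by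
  obtain ⟨hq0, hq1⟩ := hq
  unfold expectileLoss
  rcases le_total v p with h | h
  · rw [max_eq_right (sub_nonpos.2 h), max_eq_left (sub_nonneg.2 h)]
    nlinarith [sq_nonneg (p - v)]
  · rw [max_eq_left (sub_nonneg.2 h), max_eq_right (sub_nonpos.2 h)]
    nlinarith [sq_nonneg (v - p)]

lemma abs_expectileSlope_le (hq : q ∈ Set.Icc (0 : ℝ) 1) : |expectileSlope q v p| ≤ |p - v| := by
  obtain ⟨hq0, hq1⟩ := hq
  unfold expectileSlope
  rcases le_total v p with h | h
  · rw [max_eq_right (sub_nonpos.2 h), max_eq_left (sub_nonneg.2 h), mul_zero, sub_zero, abs_mul,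
      abs_of_nonneg hq0]
    exact mul_le_of_le_one_left (abs_nonneg _) hq1
  · rw [max_eq_left (sub_nonneg.2 h), max_eq_right (sub_nonpos.2 h), mul_zero, zero_sub, abs_neg,
      abs_mul, abs_of_nonneg (sub_nonneg.2 hq1), abs_sub_comm v p]
    exact mul_le_of_le_one_left (abs_nonneg _) (sub_le_self 1 hq0)

lemma expectileLoss_mem_Icc (hq : q ∈ Set.Icc (0 : ℝ) 1) (hv : v ∈ Set.Icc (0 : ℝ) 1)
    (hp : p ∈ Set.Icc (0 : ℝ) 1) : expectileLoss q v p ∈ Set.Icc (0 : ℝ) 1 :=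
  ⟨expectileLoss_nonneg hq, (expectileLoss_le_sq hq).trans
    ((sq_le_one_iff_abs_le_one _).2 (Real.dist_le_of_mem_Icc_01 hp hv))⟩

lemma expectileLoss_add_slope_mul_add_sq_le (q v p p' : ℝ) :
    expectileLoss q v p + 2 * expectileSlope q v p * (p' - p) + min q (1 - q) * (p' - p) ^ 2 ≤
      expectileLoss q v p' := by
  have sub_parts (x : ℝ) : max (x - v) 0 - max (v - x) 0 = x - v := by
    rw [← neg_sub x v, max_zero_sub_max_neg_zero_eq_self]
  have mul_parts (x : ℝ) : max (x - v) 0 * max (v - x) 0 = 0 := by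
    rcases le_total v x with h | h <;> simp [h]
  have hgap : p' - p = max (p' - v) 0 - max (v - p') 0 - (max (p - v) 0 - max (v - p) 0) := by
    rw [sub_parts, sub_parts]; ring
  have hab := mul_parts p
  have hab' := mul_parts p'
  have ha : 0 ≤ max (p - v) 0 := le_max_right _ _
  have hb : 0 ≤ max (v - p) 0 := le_max_right _ _
  have ha' : 0 ≤ max (p' - v) 0 := le_max_right _ _
  have hb' : 0 ≤ max (v - p') 0 := le_max_right _ _
  rw [expectileLoss, expectileLoss, expectileSlope, hgap]
  -- The excess of the loss over its tangent is `q U + (1 - q) V`, and `(p' - p) ^ 2 = U + V`,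
  -- where `U = (a' - a) ^ 2 + 2 a b'` and `V = (b' - b) ^ 2 + 2 a' b`.
  generalize max (p - v) 0 = a, max (v - p) 0 = b, max (p' - v) 0 = a', max (v - p') 0 = b' at *
  have above : 0 ≤ (q - min q (1 - q)) * ((a' - a) ^ 2 + 2 * (a * b')) :=
    mul_nonneg (sub_nonneg.2 (min_le_left _ _)) (by positivity)
  have below : 0 ≤ (1 - q - min q (1 - q)) * ((b' - b) ^ 2 + 2 * (a' * b)) :=
    mul_nonneg (sub_nonneg.2 (min_le_right _ _)) (by positivity)
  linear_combination above + below + 2 * (1 - min q (1 - q)) * hab - 2 * min q (1 - q) * hab'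

end ExpectileLoss

section Expectile

variable {q : ℝ} {D : Measure ℝ}

lemma integrable_expectileLoss [IsFiniteMeasure D] (hq : q ∈ Set.Icc (0 : ℝ) 1) (hD : MemLp id 2 D)
    (p : ℝ) : Integrable (fun v => expectileLoss q v p) D := by
  refine ((memLp_const p).sub hD).integrable_sq.mono' (by fun_prop) (.of_forall fun v => ?_)
  rw [Real.norm_of_nonneg (expectileLoss_nonneg hq)]
  exact expectileLoss_le_sq hq

lemma integrable_expectileSlope [IsFiniteMeasure D] (hq : q ∈ Set.Icc (0 : ℝ) 1)
    (hD : Integrable id D) (p : ℝ) : Integrable (fun v => expectileSlope q v p) D :=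
  ((integrable_const p).sub hD).mono (by fun_prop) (.of_forall fun _ => abs_expectileSlope_le hq)

lemma memLp_id_of_ae_mem_Icc [IsFiniteMeasure D] (hD : ∀ᵐ v ∂D, v ∈ Set.Icc (0 : ℝ) 1) (r : ℝ≥0∞) :
    MemLp id r D :=
  memLp_of_bounded hD (by fun_prop) r

variable [IsProbabilityMeasure D]

lemma integral_expectileLoss_add_slope_mul_add_sq_le (hq : q ∈ Set.Icc (0 : ℝ) 1)
    (hD : MemLp id 2 D) (p p' : ℝ) :
    ∫ v, expectileLoss q v p ∂D + 2 * (∫ v, expectileSlope q v p ∂D) * (p' - p) +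
      min q (1 - q) * (p' - p) ^ 2 ≤ ∫ v, expectileLoss q v p' ∂D := by
  have hloss := integrable_expectileLoss hq hD
  have hslope := ((integrable_expectileSlope hq (hD.integrable one_le_two) p).const_mul 2).mul_const
    (p' - p)
  have htangent : Integrable
      (fun v => expectileLoss q v p + 2 * expectileSlope q v p * (p' - p)) D := (hloss p).add hslope
  calc _ = ∫ v, (expectileLoss q v p + 2 * expectileSlope q v p * (p' - p) +
        min q (1 - q) * (p' - p) ^ 2) ∂D := by
        rw [integral_add htangent (integrable_const _), integral_add (hloss p) hslope,
          integral_mul_const, integral_const_mul, integral_const, probReal_univ, one_smul]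
    _ ≤ _ := integral_mono (htangent.add (integrable_const _)) (hloss p')
        fun v => expectileLoss_add_slope_mul_add_sq_le q v p p'

lemma strictMono_integral_expectileSlope (hq : q ∈ Set.Ioo (0 : ℝ) 1) (hD : MemLp id 2 D) :
    StrictMono fun p => ∫ v, expectileSlope q v p ∂D := by
  intro p p' h
  have hθ : 0 < min q (1 - q) := lt_min hq.1 (sub_pos.2 hq.2)
  have hconv := integral_expectileLoss_add_slope_mul_add_sq_le (Set.Ioo_subset_Icc_self hq) hD
  have hgrowth : 0 < min q (1 - q) * (p' - p) ^ 2 := mul_pos hθ (pow_pos (sub_pos.2 h) 2)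
  -- Adding the strong convexity inequalities at `(p, p')` and `(p', p)` cancels the losses.
  refine lt_of_mul_lt_mul_right ?_ (sub_pos.2 h).le
  linarith [hconv p p', hconv p' p]

lemma continuousOn_integral_expectileSlope (hq : q ∈ Set.Icc (0 : ℝ) 1)
    (hD : ∀ᵐ v ∂D, v ∈ Set.Icc (0 : ℝ) 1) :
    ContinuousOn (fun p => ∫ v, expectileSlope q v p ∂D) (Set.Icc 0 1) := by
  refine continuousOn_of_dominated (bound := fun _ => 1) (fun p _ => by fun_prop) (fun p hp => ?_)
    (integrable_const 1) (.of_forall fun v => by fun_prop)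
  filter_upwards [hD] with v hv
  exact (abs_expectileSlope_le hq).trans (Real.dist_le_of_mem_Icc_01 hp hv)

lemma exists_integral_expectileSlope_eq_zero (hq : q ∈ Set.Icc (0 : ℝ) 1)
    (hD : ∀ᵐ v ∂D, v ∈ Set.Icc (0 : ℝ) 1) :
    ∃ p ∈ Set.Icc (0 : ℝ) 1, ∫ v, expectileSlope q v p ∂D = 0 := by
  have hslope_zero : ∫ v, expectileSlope q v 0 ∂D ≤ 0 := by
    refine integral_nonpos_of_ae ?_
    filter_upwards [hD] with v hv
    simpa [expectileSlope, hv.1] using mul_nonneg (sub_nonneg.2 hq.2) hv.1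
  have hslope_one : 0 ≤ ∫ v, expectileSlope q v 1 ∂D := by
    refine integral_nonneg_of_ae ?_
    filter_upwards [hD] with v hv
    simpa [expectileSlope, hv.2] using mul_nonneg hq.1 (sub_nonneg.2 hv.2)
  exact intermediate_value_Icc zero_le_one (continuousOn_integral_expectileSlope hq hD)
    ⟨hslope_zero, hslope_one⟩

lemma evar_eq_of_integral_expectileSlope_eq_zero (hq : q ∈ Set.Ioo (0 : ℝ) 1) (hD : MemLp id 2 D)
    {p : ℝ} (hp : p ∈ Set.Icc (0 : ℝ) 1) (hslope : ∫ v, expectileSlope q v p ∂D = 0) :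
    evar q D = p := by
  have hθ : 0 < min q (1 - q) := lt_min hq.1 (sub_pos.2 hq.2)
  have hconv (r : ℝ) : ∫ v, expectileLoss q v p ∂D + min q (1 - q) * (r - p) ^ 2 ≤
      ∫ v, expectileLoss q v r ∂D := by
    simpa [hslope] using
      integral_expectileLoss_add_slope_mul_add_sq_le (Set.Ioo_subset_Icc_self hq) hD p r
  have hmin : IsMinOn (fun r => ∫ v, expectileLoss q v r ∂D) (Set.Icc 0 1) p := fun r _ =>
    (le_add_of_nonneg_right (by positivity)).trans (hconv r)
  have hunique : expectiles q D = {p} := by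
    refine Set.eq_singleton_iff_unique_mem.2 ⟨⟨hp, hmin⟩, fun r hr => ?_⟩
    have hr_le : ∫ v, expectileLoss q v r ∂D ≤ ∫ v, expectileLoss q v p ∂D := hr.2 hp
    have hle : min q (1 - q) * (r - p) ^ 2 ≤ 0 := by linarith [hconv r]
    have hsq : (r - p) ^ 2 ≤ 0 := nonpos_of_mul_nonpos_right hle hθ
    exact sub_eq_zero.1 (sq_nonpos_iff _ |>.1 hsq)
  rw [evar, hunique, csInf_singleton]

lemma evar_mem_Icc_and_integral_expectileSlope_evar (hq : q ∈ Set.Ioo (0 : ℝ) 1)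
    (hD : ∀ᵐ v ∂D, v ∈ Set.Icc (0 : ℝ) 1) :
    evar q D ∈ Set.Icc (0 : ℝ) 1 ∧ ∫ v, expectileSlope q v (evar q D) ∂D = 0 := by
  obtain ⟨p, hp, hslope⟩ := exists_integral_expectileSlope_eq_zero (Set.Ioo_subset_Icc_self hq) hD
  rw [evar_eq_of_integral_expectileSlope_eq_zero hq (memLp_id_of_ae_mem_Icc hD 2) hp hslope]
  exact ⟨hp, hslope⟩

lemma evar_lt_iff (hq : q ∈ Set.Ioo (0 : ℝ) 1) (hD : ∀ᵐ v ∂D, v ∈ Set.Icc (0 : ℝ) 1) (c : ℝ) :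
    evar q D < c ↔ 0 < ∫ v, expectileSlope q v c ∂D := by
  rw [← (evar_mem_Icc_and_integral_expectileSlope_evar hq hD).2]
  exact (strictMono_integral_expectileSlope hq (memLp_id_of_ae_mem_Icc hD 2)).lt_iff_lt.symm

lemma mul_sq_sub_evar_le (hq : q ∈ Set.Ioo (0 : ℝ) 1) (hD : ∀ᵐ v ∂D, v ∈ Set.Icc (0 : ℝ) 1)
    (p : ℝ) : min q (1 - q) * (p - evar q D) ^ 2 ≤
      ∫ v, (expectileLoss q v p - expectileLoss q v (evar q D)) ∂D := by
  have hq' := Set.Ioo_subset_Icc_self hq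
  have hL2 := memLp_id_of_ae_mem_Icc hD 2
  rw [integral_sub (integrable_expectileLoss hq' hL2 _) (integrable_expectileLoss hq' hL2 _),
    le_sub_iff_add_le']
  simpa [(evar_mem_Icc_and_integral_expectileSlope_evar hq hD).2] using
    integral_expectileLoss_add_slope_mul_add_sq_le hq' hL2 (evar q D) p

lemma measurable_evar_kernel {α : Type*} {mα : MeasurableSpace α} {κ : Kernel α ℝ}
    [IsMarkovKernel κ] (hq : q ∈ Set.Ioo (0 : ℝ) 1) (hκ : ∀ x, ∀ᵐ v ∂κ x, v ∈ Set.Icc (0 : ℝ) 1) :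
    Measurable fun x => evar q (κ x) := by
  refine measurable_of_Iio fun c => ?_
  have hset : (fun x => evar q (κ x)) ⁻¹' Set.Iio c = {x | 0 < ∫ v, expectileSlope q v c ∂κ x} :=
    Set.ext fun x => evar_lt_iff hq (hκ x) c
  rw [hset]
  have hslope : StronglyMeasurable fun v => expectileSlope q v c :=
    Continuous.stronglyMeasurable (by fun_prop)
  exact measurableSet_lt measurable_const hslope.integral_kernel.measurable

end Expectile

section InverseGapWeighting

/-- The coefficient `4 θ γ` of the prediction gaps in inverse gap weighting with learning
rate `γ`, where `θ = min q (1 - q)`. -/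
noncomputable def gapCoeff (q γ : ℝ) : ℝ :=
  4 * min q (1 - q) * γ

lemma gapCoeff_pos {q γ : ℝ} (hq : q ∈ Set.Ioo (0 : ℝ) 1) (hγ : 0 < γ) : 0 < gapCoeff q γ :=
  mul_pos (mul_pos four_pos (lt_min hq.1 (sub_pos.2 hq.2))) hγ

lemma le_mul_sq_add_inv {c : ℝ} (hc : 0 < c) (x : ℝ) : x ≤ c / 4 * x ^ 2 + 1 / c := by
  have hsquare : c / 4 * x ^ 2 + 1 / c - x = (c * x - 2) ^ 2 / (4 * c) := by field_simp; ring
  exact sub_nonneg.1 (hsquare ▸ by positivity)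

lemma sum_mul_le_mul_sum_mul_sq_add_inv {ι : Type*} {s : Finset ι} {w : ι → ℝ}
    (hw : ∀ i ∈ s, 0 ≤ w i) (hsum : ∑ i ∈ s, w i = 1) {c : ℝ} (hc : 0 < c) (x : ι → ℝ) :
    ∑ i ∈ s, w i * x i ≤ c / 4 * ∑ i ∈ s, w i * x i ^ 2 + 1 / c := by
  calc ∑ i ∈ s, w i * x i ≤ ∑ i ∈ s, w i * (c / 4 * x i ^ 2 + 1 / c) :=
        sum_le_sum fun i hi => mul_le_mul_of_nonneg_left (le_mul_sq_add_inv hc (x i)) (hw i hi)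
    _ = c / 4 * ∑ i ∈ s, w i * x i ^ 2 + 1 / c := by
        simp only [mul_add, sum_add_distrib, ← sum_mul, hsum, one_mul, mul_sum, mul_left_comm]

variable {A : Type*} [Fintype A] {q γ : ℝ} {f : A → I} {ahat a : A}

lemma card_le_add_gapCoeff_mul (hμ : 0 ≤ gapCoeff q γ) (hmin : ∀ b, f ahat ≤ f b) (a : A) :
    (Fintype.card A : ℝ) ≤ Fintype.card A + gapCoeff q γ * ((f a : ℝ) - f ahat) :=
  le_add_of_nonneg_right (mul_nonneg hμ (sub_nonneg.2 (hmin a)))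

variable [DecidableEq A]

lemma invGapWeight_of_ne (h : a ≠ ahat) : invGapWeight q γ f ahat a =
    1 / (Fintype.card A + gapCoeff q γ * ((f a : ℝ) - f ahat)) :=
  if_neg h

lemma sum_invGapWeight (q γ : ℝ) (f : A → I) (ahat : A) : ∑ a, invGapWeight q γ f ahat a = 1 := by
  rw [← add_sum_erase univ _ (mem_univ ahat), invGapWeight, if_pos rfl,
    sum_congr rfl fun a ha => invGapWeight_of_ne (ne_of_mem_erase ha)]
  exact sub_add_cancel _ _

lemma inv_card_le_invGapWeight_self (hμ : 0 ≤ gapCoeff q γ) (hmin : ∀ b, f ahat ≤ f b) :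
    1 / (Fintype.card A : ℝ) ≤ invGapWeight q γ f ahat ahat := by
  have hn : (0 : ℝ) < Fintype.card A := Nat.cast_pos.2 (Fintype.card_pos_iff.2 ⟨ahat⟩)
  have hothers : ∑ b ∈ univ.erase ahat, invGapWeight q γ f ahat b ≤
      ∑ b ∈ univ.erase ahat, 1 / (Fintype.card A : ℝ) := by
    refine sum_le_sum fun b hb => ?_
    rw [invGapWeight_of_ne (ne_of_mem_erase hb)]
    exact one_div_le_one_div_of_le hn (card_le_add_gapCoeff_mul hμ hmin b)
  have huniform : ∑ _b : A, 1 / (Fintype.card A : ℝ) = 1 := by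
    rw [sum_const, card_univ, nsmul_eq_mul, mul_one_div_cancel hn.ne']
  have htotal := sum_invGapWeight q γ f ahat
  rw [← add_sum_erase univ _ (mem_univ ahat)] at huniform htotal
  linarith

lemma invGapWeight_pos (hμ : 0 ≤ gapCoeff q γ) (hmin : ∀ b, f ahat ≤ f b) (a : A) :
    0 < invGapWeight q γ f ahat a := by
  have hn : (0 : ℝ) < Fintype.card A := Nat.cast_pos.2 (Fintype.card_pos_iff.2 ⟨ahat⟩)
  by_cases h : a = ahat
  · rw [h]
    exact (one_div_pos.2 hn).trans_le (inv_card_le_invGapWeight_self hμ hmin)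
  · rw [invGapWeight_of_ne h]
    exact one_div_pos.2 (hn.trans_le (card_le_add_gapCoeff_mul hμ hmin a))

lemma invGapWeight_le_one (hμ : 0 ≤ gapCoeff q γ) (hmin : ∀ b, f ahat ≤ f b) (a : A) :
    invGapWeight q γ f ahat a ≤ 1 :=
  (single_le_sum (fun b _ => (invGapWeight_pos hμ hmin b).le) (mem_univ a)).trans_eq
    (sum_invGapWeight q γ f ahat)

lemma sum_invGapWeight_mul_mem_Icc (hμ : 0 ≤ gapCoeff q γ) (hmin : ∀ b, f ahat ≤ f b)
    {x : A → ℝ} {c d : ℝ} (hx : ∀ a, x a ∈ Set.Icc c d) :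
    ∑ a, invGapWeight q γ f ahat a * x a ∈ Set.Icc c d :=
  (convex_Icc c d).sum_mem (fun a _ => (invGapWeight_pos hμ hmin a).le)
    (sum_invGapWeight q γ f ahat) fun a _ => hx a

lemma inv_invGapWeight_le (hμ : 0 ≤ gapCoeff q γ) (hmin : ∀ b, f ahat ≤ f b) (a : A) :
    1 / invGapWeight q γ f ahat a ≤ Fintype.card A + gapCoeff q γ * ((f a : ℝ) - f ahat) := by
  by_cases h : a = ahat
  · have hn : (0 : ℝ) < Fintype.card A := Nat.cast_pos.2 (Fintype.card_pos_iff.2 ⟨ahat⟩)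
    rw [h, sub_self, mul_zero, add_zero]
    exact (one_div_le hn (invGapWeight_pos hμ hmin ahat)).1
      (inv_card_le_invGapWeight_self hμ hmin)
  · rw [invGapWeight_of_ne h, one_div_one_div]

lemma sum_invGapWeight_mul_gap_le (hμ : 0 < gapCoeff q γ) (hmin : ∀ b, f ahat ≤ f b) :
    ∑ a, invGapWeight q γ f ahat a * ((f a : ℝ) - f ahat) ≤
      (Fintype.card A - 1) / gapCoeff q γ := by
  have hn : (0 : ℝ) < Fintype.card A := Nat.cast_pos.2 (Fintype.card_pos_iff.2 ⟨ahat⟩)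
  rw [← add_sum_erase univ _ (mem_univ ahat), sub_self, mul_zero, zero_add]
  calc ∑ a ∈ univ.erase ahat, invGapWeight q γ f ahat a * ((f a : ℝ) - f ahat)
      ≤ ∑ _a ∈ univ.erase ahat, 1 / gapCoeff q γ := by
        refine sum_le_sum fun a ha => ?_
        rw [invGapWeight_of_ne (ne_of_mem_erase ha), one_div_mul_eq_div,
          div_le_div_iff₀ (hn.trans_le (card_le_add_gapCoeff_mul hμ.le hmin a)) hμ]
        linarith
    _ = (Fintype.card A - 1) / gapCoeff q γ := by
        rw [sum_const, card_erase_of_mem (mem_univ _), card_univ, nsmul_eq_mul,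
          Nat.cast_pred (Fintype.card_pos_iff.2 ⟨ahat⟩), mul_one_div]

lemma gap_sub_le_mul_sum_invGapWeight_mul_sq (hμ : 0 < gapCoeff q γ) (hmin : ∀ b, f ahat ≤ f b)
    (r : A → ℝ) (b : A) :
    f ahat - r b ≤ gapCoeff q γ / 4 * ∑ a, invGapWeight q γ f ahat a * ((f a : ℝ) - r a) ^ 2 +
      Fintype.card A / gapCoeff q γ := by
  set w := invGapWeight q γ f ahat
  have hw := invGapWeight_pos hμ.le hmin
  have hsingle : w b * ((f b : ℝ) - r b) ^ 2 ≤ ∑ a, w a * ((f a : ℝ) - r a) ^ 2 :=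
    single_le_sum (f := fun a => w a * ((f a : ℝ) - r a) ^ 2)
      (fun a _ => mul_nonneg (hw a).le (sq_nonneg _)) (mem_univ b)
  have hinv : 1 / (gapCoeff q γ * w b) ≤ Fintype.card A / gapCoeff q γ + ((f b : ℝ) - f ahat) := by
    rw [mul_comm, ← div_div, div_le_iff₀ hμ, add_mul, div_mul_cancel₀ _ hμ.ne', mul_comm (_ - _)]
    exact inv_invGapWeight_le hμ.le hmin b
  have hscaled := mul_le_mul_of_nonneg_left hsingle (div_pos hμ four_pos).le
  linarith [le_mul_sq_add_inv (mul_pos hμ (hw b)) (f b - r b)]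

lemma sum_invGapWeight_mul_sub_le (hμ : 0 < gapCoeff q γ) (hmin : ∀ b, f ahat ≤ f b)
    (r : A → ℝ) (b : A) :
    ∑ a, invGapWeight q γ f ahat a * (r a - r b) ≤ 2 * Fintype.card A / gapCoeff q γ +
      gapCoeff q γ / 2 * ∑ a, invGapWeight q γ f ahat a * ((f a : ℝ) - r a) ^ 2 := by
  set w := invGapWeight q γ f ahat
  have hplayed : ∑ a, w a * (r a - f a) ≤
      gapCoeff q γ / 4 * ∑ a, w a * ((f a : ℝ) - r a) ^ 2 + 1 / gapCoeff q γ := by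
    simpa only [sub_sq_comm] using sum_mul_le_mul_sum_mul_sq_add_inv
      (fun a _ => (invGapWeight_pos hμ.le hmin a).le) (sum_invGapWeight q γ f ahat) hμ
      fun a => r a - f a
  have hgaps := sum_invGapWeight_mul_gap_le hμ hmin
  have hoptimal := gap_sub_le_mul_sum_invGapWeight_mul_sq hμ hmin r b
  calc ∑ a, w a * (r a - r b)
      = ∑ a, w a * (r a - f a) + ∑ a, w a * ((f a : ℝ) - f ahat) + (f ahat - r b) := by
        rw [← one_mul ((f ahat : ℝ) - r b), ← sum_invGapWeight q γ f ahat, sum_mul,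
          ← sum_add_distrib, ← sum_add_distrib]
        exact sum_congr rfl fun a _ => by ring
    _ ≤ _ := add_le_add (add_le_add hplayed hgaps) hoptimal
    _ = _ := by ring

lemma measurable_invGapWeight [MeasurableSpace A] [MeasurableSingletonClass A] (q γ : ℝ) (a : A) :
    Measurable fun z : (A → I) × A => invGapWeight q γ z.1 z.2 a := by
  refine measurable_from_prod_countable_left fun ahat => ?_
  by_cases h : a = ahat
  · simp only [invGapWeight, if_pos h]
    fun_prop
  · simp only [invGapWeight, if_neg h]
    fun_prop

end InverseGapWeighting

section ConditionalLaw

variable {Ω Ω' L : Type*} [MeasurableSpace Ω] {mΩ' : MeasurableSpace Ω'} [MeasurableSpace L]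
  {w : Ω' → ℝ≥0∞} {κ : Kernel Ω' L} {P : Measure Ω} {X : Ω → Ω'} {Y : Ω → L} {S : Set Ω}

-- The hypothesis `hlaw` says that, given `X`, the event `S` has probability `w X` and, on it,
-- `Y` has law `κ X`.
lemma map_restrict_eq_withDensity_compProd [IsFiniteMeasure P] [IsSFiniteKernel κ]
    (hX : Measurable X) (hY : Measurable Y) (hw : Measurable w)
    (hlaw : ∀ B', MeasurableSet B' → ∀ B, MeasurableSet B →
      P (X ⁻¹' B' ∩ (S ∩ Y ⁻¹' B)) = ∫⁻ ω in X ⁻¹' B', w (X ω) * κ (X ω) B ∂P) :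
    (P.restrict S).map (fun ω => (X ω, Y ω)) = ((P.map X).withDensity w) ⊗ₘ κ := by
  have hXY : Measurable fun ω => (X ω, Y ω) := hX.prodMk hY
  refine Measure.ext_prod fun {B' B} hB' hB => ?_
  rw [Measure.map_apply hXY (hB'.prod hB), Measure.restrict_apply (hXY (hB'.prod hB)),
    Set.mk_preimage_prod, Set.inter_right_comm, Set.inter_assoc, hlaw B' hB' B hB,
    Measure.compProd_apply_prod hB' hB, restrict_withDensity hB',
    lintegral_withDensity_eq_lintegral_mul _ hw (κ.measurable_coe hB),
    setLIntegral_map hB' (hw.mul (κ.measurable_coe hB)) hX]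
  simp only [Pi.mul_apply]

lemma setIntegral_prodMk_eq_integral_smul [IsFiniteMeasure P] [IsSFiniteKernel κ]
    (hX : Measurable X) (hY : Measurable Y) (hw : Measurable w) (hw_top : ∀ᵐ ω ∂P, w (X ω) < ∞)
    (hlaw : ∀ B', MeasurableSet B' → ∀ B, MeasurableSet B →
      P (X ⁻¹' B' ∩ (S ∩ Y ⁻¹' B)) = ∫⁻ ω in X ⁻¹' B', w (X ω) * κ (X ω) B ∂P)
    {G : Type*} [NormedAddCommGroup G] [NormedSpace ℝ G] {h : Ω' × L → G}
    (hh : StronglyMeasurable h)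
    (hint : IntegrableOn (fun ω => h (X ω, Y ω)) S P) :
    ∫ ω in S, h (X ω, Y ω) ∂P = ∫ ω, (w (X ω)).toReal • ∫ l, h (X ω, l) ∂κ (X ω) ∂P := by
  have hXY : Measurable fun ω => (X ω, Y ω) := hX.prodMk hY
  have hmap := map_restrict_eq_withDensity_compProd hX hY hw hlaw
  have hint_map : Integrable h ((P.restrict S).map fun ω => (X ω, Y ω)) :=
    (integrable_map_measure hh.aestronglyMeasurable hXY.aemeasurable).2 hint
  have hw_top_map : ∀ᵐ z ∂P.map X, w z < ∞ :=
    (ae_map_iff hX.aemeasurable (measurableSet_lt hw measurable_const)).2 hw_top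
  have hinner : StronglyMeasurable fun z => (w z).toReal • ∫ l, h (z, l) ∂κ z :=
    hw.ennreal_toReal.stronglyMeasurable.smul hh.integral_kernel_prod_right'
  rw [← integral_map hXY.aemeasurable hh.aestronglyMeasurable, hmap,
    Measure.integral_compProd (hmap ▸ hint_map),
    integral_withDensity_eq_integral_toReal_smul hw hw_top_map,
    integral_map hX.aemeasurable hinner.aestronglyMeasurable]

end ConditionalLaw

section RandomIndex

variable {A : Type*} [MeasurableSpace A] [MeasurableSingletonClass A]

lemma measurable_eval_prod [Countable A] {S : Type*} [MeasurableSpace S] :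
    Measurable fun z : (A → S) × A => z.1 z.2 :=
  measurable_from_prod_countable_left fun a => measurable_pi_apply a

lemma integral_eq_sum_setIntegral_fiber [Fintype A] {Ω G : Type*} [MeasurableSpace Ω]
    {P : Measure Ω} [NormedAddCommGroup G] [NormedSpace ℝ G] {act : Ω → A} (hact : Measurable act)
    {g : A → Ω → G} (hg : ∀ a, Integrable (g a) P) :
    ∫ ω, g (act ω) ω ∂P = ∑ a, ∫ ω in act ⁻¹' {a}, g a ω ∂P := by
  have hfiber (a : A) : MeasurableSet (act ⁻¹' {a}) := hact (measurableSet_singleton a)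
  have hcongr (a : A) : Set.EqOn (fun ω => g (act ω) ω) (g a) (act ⁻¹' {a}) :=
    fun ω hω => congrArg (g · ω) hω
  rw [← setIntegral_univ, ← Set.preimage_univ (f := act), ← Set.iUnion_of_singleton A,
    Set.preimage_iUnion, integral_iUnion_fintype hfiber
      (fun a b hab => (Set.disjoint_singleton.2 hab).preimage act)
      (fun a => (integrableOn_congr_fun (hcongr a) (hfiber a)).2 (hg a).integrableOn)]
  exact sum_congr rfl fun a _ => setIntegral_congr_fun (hfiber a) (hcongr a)

end RandomIndex

lemma exists_pos_div_add_mul_eq_two_mul_sqrt {a b : ℝ} (ha : 0 < a) (hb : 0 < b) :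
    ∃ γ : ℝ, 0 < γ ∧ a / γ + b * γ = 2 * √(a * b) := by
  have hs := Real.sqrt_pos.2 (mul_pos ha hb)
  refine ⟨√(a * b) / b, div_pos hs hb, ?_⟩
  have hsq : √(a * b) ^ 2 = a * b := Real.sq_sqrt (mul_pos ha hb).le
  field_simp
  linear_combination -hsq

lemma sqrt_div_le_one_div_mul_sqrt {c : ℝ} (hc0 : 0 < c) (hc1 : c ≤ 1) (x : ℝ) :
    √(x / c) ≤ 1 / c * √x := by
  have hle : c ≤ √c := Real.le_sqrt_of_sq_le (pow_le_of_le_one hc0.le hc1 two_ne_zero)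
  rw [Real.sqrt_div' _ hc0.le, one_div_mul_eq_div]
  exact div_le_div_of_nonneg_left (Real.sqrt_nonneg _) hc0 hle

section LossFunction

variable {A : Type*}

lemma measurable_coe_eval (a : A) : Measurable fun l : A → I => (l a : ℝ) := by
  fun_prop

lemma ae_map_eval_mem_Icc (D : Measure (A → I)) (a : A) :
    ∀ᵐ v ∂D.map (fun l : A → I => (l a : ℝ)), v ∈ Set.Icc (0 : ℝ) 1 :=
  (ae_map_iff (p := (· ∈ Set.Icc (0 : ℝ) 1)) (measurable_coe_eval a).aemeasurable
    measurableSet_Icc).2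
    (.of_forall fun l => (l a).2)

lemma isProbabilityMeasure_map_eval (D : Measure (A → I)) [IsProbabilityMeasure D] (a : A) :
    IsProbabilityMeasure (D.map fun l : A → I => (l a : ℝ)) :=
  Measure.isProbabilityMeasure_map (measurable_coe_eval a).aemeasurable

end LossFunction

namespace Interaction

variable {X A Ω : Type*} [MeasurableSpace Ω]

/-- The amount by which the expectile loss of the oracle's prediction for action `a` in round `t`
exceeds that of the risk of `a`, when the realized loss function is `l`. -/
noncomputable def excessLoss (E : Interaction X A Ω) (oracle : RegOracle X A) (q : ℝ) (t : ℕ)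
    (ω : Ω) (a : A) (l : A → I) : ℝ :=
  expectileLoss q (l a) (E.pred oracle t ω a) - expectileLoss q (l a) (E.risk q t ω a)

/-- The mean squared error of the oracle's predictions of the risk in round `t`, averaged over the
algorithm's action distribution. -/
noncomputable def sqError [Fintype A] [DecidableEq A] (E : Interaction X A Ω)
    (oracle : RegOracle X A) (q γ : ℝ) (t : ℕ) (ω : Ω) : ℝ :=
  ∑ a, E.prob oracle q γ t ω a * ((E.pred oracle t ω a : ℝ) - E.risk q t ω a) ^ 2

lemma Realizable.ae_sum_excessLoss_le {E : Interaction X A Ω} {P : Measure Ω}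
    {oracle : RegOracle X A} {q : ℝ} {T : ℕ} {F : Set (X → A → I)} {R : ℝ}
    (hF : E.Realizable P q F T) (hR : oracle.HasRegret q F T R) :
    ∀ᵐ ω ∂P, ∑ t ∈ range T, E.excessLoss oracle q t ω (E.act t ω) (E.loss t ω) ≤ R := by
  filter_upwards [hF] with ω ⟨f, hf, hrisk⟩
  calc ∑ t ∈ range T, E.excessLoss oracle q t ω (E.act t ω) (E.loss t ω)
      = ∑ t ∈ range T, (expectileLoss q (E.loss t ω (E.act t ω)) (E.pred oracle t ω (E.act t ω)) -
          expectileLoss q (E.loss t ω (E.act t ω)) (f (E.ctx t ω) (E.act t ω))) :=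
        sum_congr rfl fun t ht => by rw [hrisk t (mem_range.1 ht), excessLoss]
    _ ≤ R := hR _ _ _ f hf

namespace FollowsProtocol

variable [MeasurableSpace X] [Fintype A] [DecidableEq A] [MeasurableSpace A]
  {E : Interaction X A Ω} {P : Measure Ω} {oracle : RegOracle X A} {q γ : ℝ} {T t : ℕ}

/-- The environment's choice of the law of the loss function in round `t`, as a Markov kernel from
the information available at that point. -/
noncomputable def lossKernel (hE : E.FollowsProtocol P oracle q γ T) (ht : t < T) :
    Kernel[E.known t] Ω (A → I) :=
  @Kernel.mk _ _ (E.known t) _ (E.lossLaw t) (hE.measurable_lossLaw t ht)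

instance (hE : E.FollowsProtocol P oracle q γ T) (ht : t < T) :
    IsMarkovKernel (hE.lossKernel ht) :=
  ⟨hE.isProbabilityMeasure_lossLaw t ht⟩

lemma measurable_risk (hE : E.FollowsProtocol P oracle q γ T) (hq : q ∈ Set.Ioo (0 : ℝ) 1)
    (ht : t < T) (a : A) : Measurable[E.known t] fun ω => E.risk q t ω a := by
  have hm := measurable_coe_eval a
  have : IsMarkovKernel ((hE.lossKernel ht).map fun l : A → I => (l a : ℝ)) :=
    Kernel.IsMarkovKernel.map _ hm
  have hmap (ω : Ω) : (hE.lossKernel ht).map (fun l : A → I => (l a : ℝ)) ω =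
      (E.lossLaw t ω).map fun l : A → I => (l a : ℝ) := Kernel.map_apply _ hm ω
  have hevar := measurable_evar_kernel hq
    (κ := (hE.lossKernel ht).map fun l : A → I => (l a : ℝ))
    fun ω => hmap ω ▸ ae_map_eval_mem_Icc (E.lossLaw t ω) a
  simp only [hmap] at hevar
  exact hevar

lemma risk_mem_Icc (hE : E.FollowsProtocol P oracle q γ T) (hq : q ∈ Set.Ioo (0 : ℝ) 1)
    (ht : t < T) (ω : Ω) (a : A) : E.risk q t ω a ∈ Set.Icc (0 : ℝ) 1 :=
  have := hE.isProbabilityMeasure_lossLaw t ht ω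
  have := isProbabilityMeasure_map_eval (E.lossLaw t ω) a
  (evar_mem_Icc_and_integral_expectileSlope_evar hq (ae_map_eval_mem_Icc _ a)).1

lemma abs_excessLoss_le_one (hE : E.FollowsProtocol P oracle q γ T) (hq : q ∈ Set.Ioo (0 : ℝ) 1)
    (ht : t < T) (ω : Ω) (a : A) (l : A → I) : |E.excessLoss oracle q t ω a l| ≤ 1 :=
  have hq' := Set.Ioo_subset_Icc_self hq
  Real.dist_le_of_mem_Icc_01 (expectileLoss_mem_Icc hq' (l a).2 (E.pred oracle t ω a).2)
    (expectileLoss_mem_Icc hq' (l a).2 (hE.risk_mem_Icc hq ht ω a))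

lemma mul_sq_pred_sub_risk_le (hE : E.FollowsProtocol P oracle q γ T)
    (hq : q ∈ Set.Ioo (0 : ℝ) 1) (ht : t < T) (ω : Ω) (a : A) :
    min q (1 - q) * ((E.pred oracle t ω a : ℝ) - E.risk q t ω a) ^ 2 ≤
      ∫ l, E.excessLoss oracle q t ω a l ∂E.lossLaw t ω := by
  have := hE.isProbabilityMeasure_lossLaw t ht ω
  have := isProbabilityMeasure_map_eval (E.lossLaw t ω) a
  have hle := mul_sq_sub_evar_le hq (ae_map_eval_mem_Icc (E.lossLaw t ω) a) (E.pred oracle t ω a)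
  rwa [integral_map (measurable_coe_eval a).aemeasurable (by fun_prop)] at hle

lemma ae_forall_pred_greedy_le (hE : E.FollowsProtocol P oracle q γ T) :
    ∀ᵐ ω ∂P, ∀ t < T, ∀ a, E.pred oracle t ω (E.greedy t ω) ≤ E.pred oracle t ω a :=
  ae_all_iff.2 fun t => ae_all_iff.2 fun ht => hE.greedy_le t ht

lemma ae_regCB_le [Nonempty A] (hE : E.FollowsProtocol P oracle q γ T) (hμ : 0 < gapCoeff q γ) :
    ∀ᵐ ω ∂P, E.regCB oracle q γ T ω ≤ 2 * Fintype.card A * T / gapCoeff q γ +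
      gapCoeff q γ / 2 * ∑ t ∈ range T, E.sqError oracle q γ t ω := by
  filter_upwards [hE.ae_forall_pred_greedy_le] with ω hgreedy
  calc E.regCB oracle q γ T ω
      ≤ ∑ t ∈ range T, (2 * Fintype.card A / gapCoeff q γ +
          gapCoeff q γ / 2 * E.sqError oracle q γ t ω) := by
        refine sum_le_sum fun t ht => ?_
        obtain ⟨b, hb⟩ := exists_eq_ciInf_of_finite (f := E.risk q t ω)
        rw [← hb]
        exact sum_invGapWeight_mul_sub_le hμ (hgreedy t (mem_range.1 ht)) (E.risk q t ω) b
    _ = _ := by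
        rw [sum_add_distrib, ← mul_sum, sum_const, card_range, nsmul_eq_mul, ← mul_div_assoc,
          mul_comm (T : ℝ)]

variable [MeasurableSingletonClass A]

lemma measurable_pred (hE : E.FollowsProtocol P oracle q γ T) (ho : oracle.IsMeasurable)
    (ht : t < T) (a : A) : Measurable[E.known t] fun ω => E.pred oracle t ω a := by
  have hexamples : Measurable[E.known t] fun ω => examples (fun s => E.ctx s ω)
      (fun s => E.act s ω) (fun s => E.loss s ω (E.act s ω)) t := by
    refine @measurable_pi_lambda _ _ _ (E.known t) _ _ fun s => ?_
    have hs : (s : ℕ) < T := s.2.trans ht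
    have hctx := (hE.measurable_ctx s hs).mono (E.known.mono s.2.le) le_rfl
    have hact := (hE.measurable_act s hs).mono (E.known.mono s.2) le_rfl
    have hloss := (hE.measurable_loss s hs).mono (E.known.mono s.2) le_rfl
    exact hctx.prodMk (hact.prodMk (measurable_eval_prod.comp (hloss.prodMk hact)))
  exact (ho t a).comp (hexamples.prodMk (hE.measurable_ctx t ht))

lemma measurable_prob (hE : E.FollowsProtocol P oracle q γ T) (ho : oracle.IsMeasurable)
    (ht : t < T) (a : A) : Measurable[E.known t] fun ω => E.prob oracle q γ t ω a :=
  (measurable_invGapWeight q γ a).comp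
    ((@measurable_pi_lambda _ _ _ (E.known t) _ _ fun b => hE.measurable_pred ho ht b).prodMk
      (hE.measurable_greedy t ht))

lemma stronglyMeasurable_excessLoss (hE : E.FollowsProtocol P oracle q γ T)
    (ho : oracle.IsMeasurable) (hq : q ∈ Set.Ioo (0 : ℝ) 1) (ht : t < T) (a : A) :
    StronglyMeasurable[(E.known t).prod MeasurableSpace.pi]
      fun z : Ω × (A → I) => E.excessLoss oracle q t z.1 a z.2 := by
  have hfst : Measurable[(E.known t).prod MeasurableSpace.pi, E.known t]
      (Prod.fst : Ω × (A → I) → Ω) := measurable_fst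
  have hsnd : Measurable[(E.known t).prod MeasurableSpace.pi] (Prod.snd : Ω × (A → I) → A → I) :=
    measurable_snd
  have hpred := (hE.measurable_pred ho ht a).subtype_val.comp hfst
  have hrisk := (hE.measurable_risk hq ht a).comp hfst
  have hloss := (measurable_coe_eval a).comp hsnd
  have hℓ := (continuous_expectileLoss q).measurable
  exact ((hℓ.comp (hloss.prodMk hpred)).sub (hℓ.comp (hloss.prodMk hrisk))).stronglyMeasurable

lemma measurable_excessLoss_loss (hE : E.FollowsProtocol P oracle q γ T)
    (ho : oracle.IsMeasurable) (hq : q ∈ Set.Ioo (0 : ℝ) 1) (ht : t < T) (a : A) :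
    Measurable fun ω => E.excessLoss oracle q t ω a (E.loss t ω) := by
  have hloss := (hE.measurable_loss t ht).mono (E.known.le _) le_rfl
  have hpair := (measurable_id'' (E.known.le t)).prodMk hloss
  have hcomp := (hE.stronglyMeasurable_excessLoss ho hq ht a).measurable.comp hpair
  exact hcomp

lemma integrable_excessLoss_loss [IsFiniteMeasure P] (hE : E.FollowsProtocol P oracle q γ T)
    (ho : oracle.IsMeasurable) (hq : q ∈ Set.Ioo (0 : ℝ) 1) (ht : t < T) (a : A) :
    Integrable (fun ω => E.excessLoss oracle q t ω a (E.loss t ω)) P :=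
  .of_bound (hE.measurable_excessLoss_loss ho hq ht a).aestronglyMeasurable 1
    (.of_forall fun ω => hE.abs_excessLoss_le_one hq ht ω a _)

lemma integrable_excessLoss_act_loss [IsFiniteMeasure P] (hE : E.FollowsProtocol P oracle q γ T)
    (ho : oracle.IsMeasurable) (hq : q ∈ Set.Ioo (0 : ℝ) 1) (ht : t < T) :
    Integrable (fun ω => E.excessLoss oracle q t ω (E.act t ω) (E.loss t ω)) P := by
  have hmeas : Measurable fun z : Ω × A => E.excessLoss oracle q t z.1 z.2 (E.loss t z.1) :=
    measurable_from_prod_countable_left (hE.measurable_excessLoss_loss ho hq ht)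
  have hact := (hE.measurable_act t ht).mono (E.known.le _) le_rfl
  exact .of_bound (hmeas.comp (measurable_id.prodMk hact)).aestronglyMeasurable 1
    (.of_forall fun ω => hE.abs_excessLoss_le_one hq ht ω _ _)

lemma integrable_sqError [IsFiniteMeasure P] (hE : E.FollowsProtocol P oracle q γ T)
    (ho : oracle.IsMeasurable) (hq : q ∈ Set.Ioo (0 : ℝ) 1) (hμ : 0 ≤ gapCoeff q γ) (ht : t < T) :
    Integrable (E.sqError oracle q γ t) P := by
  have hmeas : Measurable[E.known t] (E.sqError oracle q γ t) :=
    measurable_fun_sum _ fun a _ => (hE.measurable_prob ho ht a).mul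
      (((hE.measurable_pred ho ht a).subtype_val.sub (hE.measurable_risk hq ht a)).pow_const 2)
  refine .of_mem_Icc 0 1 (hmeas.mono (E.known.le t) le_rfl).aemeasurable ?_
  filter_upwards [hE.greedy_le t ht] with ω hgreedy
  exact sum_invGapWeight_mul_mem_Icc hμ hgreedy fun a => ⟨sq_nonneg _,
    (sq_le_one_iff_abs_le_one _).2
      (Real.dist_le_of_mem_Icc_01 (E.pred oracle t ω a).2 (hE.risk_mem_Icc hq ht ω a))⟩

lemma integrable_regCB [Nonempty A] [IsFiniteMeasure P] (hE : E.FollowsProtocol P oracle q γ T)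
    (ho : oracle.IsMeasurable) (hq : q ∈ Set.Ioo (0 : ℝ) 1) (hμ : 0 ≤ gapCoeff q γ) :
    Integrable (E.regCB oracle q γ T) P := by
  refine integrable_finsetSum _ fun t ht => ?_
  have ht := mem_range.1 ht
  have hrisk (b : A) := hE.measurable_risk hq ht b
  have hmeas : Measurable[E.known t] fun ω =>
      ∑ a, E.prob oracle q γ t ω a * (E.risk q t ω a - ⨅ b, E.risk q t ω b) :=
    measurable_fun_sum _ fun a _ =>
      (hE.measurable_prob ho ht a).mul ((hrisk a).sub (Measurable.iInf hrisk))
  refine .of_mem_Icc 0 1 (hmeas.mono (E.known.le t) le_rfl).aemeasurable ?_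
  filter_upwards [hE.greedy_le t ht] with ω hgreedy
  refine sum_invGapWeight_mul_mem_Icc hμ hgreedy fun a => ?_
  obtain ⟨b, hb⟩ := exists_eq_ciInf_of_finite (f := E.risk q t ω)
  refine ⟨sub_nonneg.2 (ciInf_le (Set.finite_range _).bddBelow a), ?_⟩
  linarith [(hE.risk_mem_Icc hq ht ω a).2, (hE.risk_mem_Icc hq ht ω b).1]

lemma setIntegral_excessLoss_eq [IsFiniteMeasure P] (hE : E.FollowsProtocol P oracle q γ T)
    (ho : oracle.IsMeasurable) (hq : q ∈ Set.Ioo (0 : ℝ) 1) (hμ : 0 ≤ gapCoeff q γ) (ht : t < T)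
    (a : A) :
    ∫ ω in E.act t ⁻¹' {a}, E.excessLoss oracle q t ω a (E.loss t ω) ∂P =
      ∫ ω, E.prob oracle q γ t ω a * ∫ l, E.excessLoss oracle q t ω a l ∂E.lossLaw t ω ∂P := by
  have hcond := setIntegral_prodMk_eq_integral_smul (measurable_id'' (E.known.le t))
    ((hE.measurable_loss t ht).mono (E.known.le _) le_rfl)
    (hE.measurable_prob ho ht a).ennreal_ofReal (.of_forall fun _ => ENNReal.ofReal_lt_top)
    (κ := hE.lossKernel ht) (fun S hS B hB => hE.law_act_loss t ht S hS a B hB)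
    (hE.stronglyMeasurable_excessLoss ho hq ht a)
    (hE.integrable_excessLoss_loss ho hq ht a).integrableOn
  refine hcond.trans (integral_congr_ae ?_)
  filter_upwards [hE.greedy_le t ht] with ω hgreedy
  exact congrArg (· * _) (ENNReal.toReal_ofReal (invGapWeight_pos hμ hgreedy a).le)

lemma integrable_prob_mul_integral_excessLoss [IsFiniteMeasure P]
    (hE : E.FollowsProtocol P oracle q γ T) (ho : oracle.IsMeasurable)
    (hq : q ∈ Set.Ioo (0 : ℝ) 1) (hμ : 0 ≤ gapCoeff q γ) (ht : t < T) (a : A) :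
    Integrable (fun ω => E.prob oracle q γ t ω a *
      ∫ l, E.excessLoss oracle q t ω a l ∂E.lossLaw t ω) P := by
  have hprob : Integrable (fun ω => E.prob oracle q γ t ω a) P := by
    refine .of_mem_Icc 0 1
      ((hE.measurable_prob ho ht a).mono (E.known.le t) le_rfl).aemeasurable ?_
    filter_upwards [hE.greedy_le t ht] with ω hgreedy
    exact ⟨(invGapWeight_pos hμ hgreedy a).le, invGapWeight_le_one hμ hgreedy a⟩
  have hmean : StronglyMeasurable[E.known t] fun ω =>
      ∫ l, E.excessLoss oracle q t ω a l ∂hE.lossKernel ht ω :=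
    (hE.stronglyMeasurable_excessLoss ho hq ht a).integral_kernel_prod_right'
  refine hprob.mul_bdd (c := 1) (hmean.mono (E.known.le t)).aestronglyMeasurable
    (.of_forall fun ω => ?_)
  have := hE.isProbabilityMeasure_lossLaw t ht ω
  simpa using norm_integral_le_of_norm_le_const (μ := E.lossLaw t ω)
    (f := E.excessLoss oracle q t ω a) (.of_forall (hE.abs_excessLoss_le_one hq ht ω a))

lemma mul_integral_sqError_le [IsFiniteMeasure P] (hE : E.FollowsProtocol P oracle q γ T)
    (ho : oracle.IsMeasurable) (hq : q ∈ Set.Ioo (0 : ℝ) 1) (hμ : 0 ≤ gapCoeff q γ) (ht : t < T) :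
    min q (1 - q) * ∫ ω, E.sqError oracle q γ t ω ∂P ≤
      ∫ ω, E.excessLoss oracle q t ω (E.act t ω) (E.loss t ω) ∂P := by
  have hmean (a : A) := hE.integrable_prob_mul_integral_excessLoss ho hq hμ ht a
  calc min q (1 - q) * ∫ ω, E.sqError oracle q γ t ω ∂P
      = ∫ ω, min q (1 - q) * E.sqError oracle q γ t ω ∂P := (integral_const_mul _ _).symm
    _ ≤ ∫ ω, ∑ a, E.prob oracle q γ t ω a *
          ∫ l, E.excessLoss oracle q t ω a l ∂E.lossLaw t ω ∂P := by
        refine integral_mono_ae ((hE.integrable_sqError ho hq hμ ht).const_mul _)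
          (integrable_finsetSum _ fun a _ => hmean a) ?_
        filter_upwards [hE.greedy_le t ht] with ω hgreedy
        rw [sqError, mul_sum]
        refine sum_le_sum fun a _ => ?_
        rw [mul_left_comm]
        exact mul_le_mul_of_nonneg_left (hE.mul_sq_pred_sub_risk_le hq ht ω a)
          (invGapWeight_pos hμ hgreedy a).le
    _ = ∑ a, ∫ ω in E.act t ⁻¹' {a}, E.excessLoss oracle q t ω a (E.loss t ω) ∂P := by
        rw [integral_finsetSum _ fun a _ => hmean a]
        exact sum_congr rfl fun a _ => (hE.setIntegral_excessLoss_eq ho hq hμ ht a).symm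
    _ = ∫ ω, E.excessLoss oracle q t ω (E.act t ω) (E.loss t ω) ∂P :=
        (integral_eq_sum_setIntegral_fiber
          ((hE.measurable_act t ht).mono (E.known.le _) le_rfl)
          fun a => hE.integrable_excessLoss_loss ho hq ht a).symm

lemma mul_sum_integral_sqError_le [IsProbabilityMeasure P] (hE : E.FollowsProtocol P oracle q γ T)
    (ho : oracle.IsMeasurable) (hq : q ∈ Set.Ioo (0 : ℝ) 1) (hμ : 0 ≤ gapCoeff q γ)
    {F : Set (X → A → I)} {R : ℝ} (hR : oracle.HasRegret q F T R) (hF : E.Realizable P q F T) :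
    min q (1 - q) * ∑ t ∈ range T, ∫ ω, E.sqError oracle q γ t ω ∂P ≤ R := by
  have hint (t : ℕ) (ht : t ∈ range T) := hE.integrable_excessLoss_act_loss ho hq (mem_range.1 ht)
  calc min q (1 - q) * ∑ t ∈ range T, ∫ ω, E.sqError oracle q γ t ω ∂P
      ≤ ∑ t ∈ range T, ∫ ω, E.excessLoss oracle q t ω (E.act t ω) (E.loss t ω) ∂P := by
        rw [mul_sum]
        exact sum_le_sum fun t ht => hE.mul_integral_sqError_le ho hq hμ (mem_range.1 ht)
    _ = ∫ ω, ∑ t ∈ range T, E.excessLoss oracle q t ω (E.act t ω) (E.loss t ω) ∂P :=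
        (integral_finsetSum _ hint).symm
    _ ≤ ∫ _ω, R ∂P :=
        integral_mono_ae (integrable_finsetSum _ hint) (integrable_const _)
          (hF.ae_sum_excessLoss_le hR)
    _ = R := by simp

lemma integral_regCB_le [Nonempty A] [IsProbabilityMeasure P]
    (hE : E.FollowsProtocol P oracle q γ T) (ho : oracle.IsMeasurable)
    (hq : q ∈ Set.Ioo (0 : ℝ) 1) (hγ : 0 < γ) {F : Set (X → A → I)} {R : ℝ}
    (hR : oracle.HasRegret q F T R) (hF : E.Realizable P q F T) :
    ∫ ω, E.regCB oracle q γ T ω ∂P ≤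
      Fintype.card A * T / (2 * min q (1 - q)) / γ + 2 * R * γ := by
  have hμ := gapCoeff_pos hq hγ
  have hint (t : ℕ) (ht : t ∈ range T) := hE.integrable_sqError ho hq hμ.le (mem_range.1 ht)
  have hint_sum := (integrable_finsetSum (range T) hint).const_mul (gapCoeff q γ / 2)
  calc ∫ ω, E.regCB oracle q γ T ω ∂P
      ≤ ∫ ω, (2 * Fintype.card A * T / gapCoeff q γ +
          gapCoeff q γ / 2 * ∑ t ∈ range T, E.sqError oracle q γ t ω) ∂P :=
        integral_mono_ae (hE.integrable_regCB ho hq hμ.le)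
          ((integrable_const _).add hint_sum) (hE.ae_regCB_le hμ)
    _ = 2 * Fintype.card A * T / gapCoeff q γ +
          2 * γ * (min q (1 - q) * ∑ t ∈ range T, ∫ ω, E.sqError oracle q γ t ω ∂P) := by
        rw [integral_add (integrable_const _) hint_sum, integral_const, probReal_univ, one_smul,
          integral_const_mul, integral_finsetSum _ hint, gapCoeff]
        ring
    _ ≤ 2 * Fintype.card A * T / gapCoeff q γ + 2 * γ * R := by
        gcongr
        exact hE.mul_sum_integral_sqError_le ho hq hμ.le hR hF
    _ = Fintype.card A * T / (2 * min q (1 - q)) / γ + 2 * R * γ := by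
        rw [gapCoeff]; field_simp; ring

end FollowsProtocol

end Interaction

end ExpectileBandit

theorem theorem1 :
    ∃ C : ℝ, 0 < C ∧
      ∀ (n T : ℕ) (q R : ℝ), 0 < q → q < 1 → 0 < R →
        ∃ γ : ℝ, 0 < γ ∧
          ∀ (A : Type*) [Fintype A] [DecidableEq A] [Nonempty A] [MeasurableSpace A]
            [MeasurableSingletonClass A] (X : Type*) [MeasurableSpace X]
            (F : Set (X → A → I)) (oracle : RegOracle X A)
            (Ω : Type*) [MeasurableSpace Ω] (P : Measure Ω) [IsProbabilityMeasure P]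
            (E : Interaction X A Ω),
            Fintype.card A = n →
            oracle.IsMeasurable →
            oracle.HasRegret q F T R →
            E.FollowsProtocol P oracle q γ T →
            E.Realizable P q F T →
              Integrable (E.regCB oracle q γ T) P ∧
              ∫ ω, E.regCB oracle q γ T ω ∂P ≤
                C * (1 / min q (1 - q) * √((n : ℝ) * T * R)) := by
  refine ⟨2, two_pos, fun n T q R hq0 hq1 hR => ?_⟩
  have hq : q ∈ Set.Ioo (0 : ℝ) 1 := ⟨hq0, hq1⟩
  have hθ : 0 < min q (1 - q) := lt_min hq0 (sub_pos.2 hq1)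
  rcases (n * T).eq_zero_or_pos with hnT | hnT
  · refine ⟨1, one_pos, fun A _ _ _ _ _ X _ F oracle Ω _ P _ E hA ho _ hE _ =>
      ⟨hE.integrable_regCB ho hq (gapCoeff_pos hq one_pos).le, ?_⟩⟩
    obtain rfl : T = 0 := (mul_eq_zero.1 hnT).resolve_left (hA ▸ Fintype.card_ne_zero)
    simp [Interaction.regCB]
  · have hnT : (0 : ℝ) < n * T := by exact_mod_cast hnT
    obtain ⟨γ, hγ, hopt⟩ := exists_pos_div_add_mul_eq_two_mul_sqrt
      (div_pos hnT (mul_pos two_pos hθ)) (mul_pos two_pos hR)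
    refine ⟨γ, hγ, fun A _ _ _ _ _ X _ F oracle Ω _ P _ E hA ho hreg hE hF =>
      ⟨hE.integrable_regCB ho hq (gapCoeff_pos hq hγ).le, ?_⟩⟩
    calc ∫ ω, E.regCB oracle q γ T ω ∂P
        ≤ n * T / (2 * min q (1 - q)) / γ + 2 * R * γ :=
          hA ▸ hE.integral_regCB_le ho hq hγ hreg hF
      _ = 2 * √(n * T * R / min q (1 - q)) := by rw [hopt]; congr 2; field_simp
      _ ≤ 2 * (1 / min q (1 - q) * √(n * T * R)) :=
          mul_le_mul_of_nonneg_left (sqrt_div_le_one_div_mul_sqrt hθ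
            ((min_le_left _ _).trans hq1.le) _) two_pos.le
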